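/- **Corollary (regret of IDS-F, IDS-UCB, DIDS-F, DIDS-UCB).** *Setting.* Let $\mathcal X$ be a compact metric space, let $f:\mathcal X\to\mathbb R$ and $\rho:\mathcal X\to(0,\infty)$ be continuous, and set $\Delta(x)=\max_{x'}f(x')-f(x)$ and $S=\max_x\Delta(x)$. In round $t=1,2,\dots$ a policy $\pi$ draws $x_t\sim\pi_t$, a probability measure on $\mathcal X$ that depends measurably on the history $(x_1,y_1,\dots,x_{t-1},y_{t-1})$, and observes $y_t=f(x_t)+\epsilon_t$ with a real noise process $\epsilon_t$. The regret is $R_T=\max_x\sum_{t\le T}(f(x)-f(x_t))$. Let $\hat f_t$ (estimator), $\sigma_t\ge 0$ (confidence width) and $\beta_t>0$ (scale factor) be measurable functions of the history before round $t$, with $\hat f_t$ and $\sigma_t$ continuous in $x$ and $\beta_t$ almost surely non-decreasing in $t$. Suppose that, with probability at least $1-\alpha$, $|f(x)-\hat f_t(x)|\le\beta_t\sigma_t(x)$ for all $t\ge1$ and $x\in\mathcal X$. Let $$\Delta_t^+(x)=\max_{x'}\big(\hat f_t(x')+\beta_t\sigma_t(x')\big)-\big(\hat f_t(x)-\beta_t\sigma_t(x)\big),\qquad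 \mathcal X_t^{\mathrm{UCB}}=\operatorname{argmax}_x\big(\hat f_t(x)+\beta_t\sigma_t(x)\big),\qquad R=\sup_{t\ge1}\min_{x\in\mathcal X_t^{\mathrm{UCB}}}\rho(x).$$ For an information gain $I_t$ let $\Psi_t^+(\mu)=(\mathbb E_\mu\Delta_t^+)^2/\mathbb E_\mu I_t$, with $0/0=0$ and $a/0=\infty$ for $a>0$, and let $\gamma_T=\operatorname{ess\,sup}\sum_{t\le T}I_t(x_t)$. IDS is any policy for which $\pi_t$ minimizes $\Psi_t^+$ over all probability measures on $\mathcal X$; DIDS is any policy that plays a single action minimizing $x\mapsto\Psi_t^+(\delta_x)$. The information gains are * F: $I_t(x)=\log\big(1+\sigma_t(x)^2/\rho(x)^2\big)$; * UCB: $I_t(x)=\log\big(\sigma_t(u_t)^2/\sigma_t(u_t|x)^2\big)$ (read as $0$ if $\sigma_t(u_t)=0$), where $u_t\in\mathcal X_t^{\mathrm{UCB}}$ has minimal noise $\rho(u_t)=\min_{\mathcal X_t^{\mathrm{UCB}}}\rho$ and is chosen measurably, and $\sigma_t(u|x)$ is the confidence width at $u$ after $x$ has been evaluated. For UCB the widths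 are those of regularized weighted least squares: $\sigma_t(x)^2=\langle\varphi(x),V_t^{-1}\varphi(x)\rangle$ with $V_t=V_0+\sum_{s<t}\rho(x_s)^{-2}\varphi(x_s)\otimes\varphi(x_s)$, for a continuous feature map $\varphi$ from $\mathcal X$ to a real Hilbert space and a bounded, invertible, positive self-adjoint operator $V_0$ (this covers linear and RKHS regression). *Claim.* For every $B$ there is a constant $C>0$, depending only on $B$, such that in every such setting in which almost surely $I_t(x)\le B$ for all $t$ and $x$, and for every $\alpha\ge 0$ and $\delta\in(0,1)$: 1. For IDS-F and IDS-UCB there is a deterministic $T_0$ such that, with probability at least $1-\alpha-\delta$, for all $T\ge \max(T_0,1)$, $$R_T\le C\,R\,\beta_T\sqrt{T\,(\gamma_T+\log\tfrac1\delta)};$$ moreover, with probability at least $1-\alpha-\delta$, for all $T\ge1$, $$R_T\le C\Big(R\,\beta_T\sqrt{T\,(\gamma_T+\log\tfrac2\delta)}+S\log\tfrac{2T}{\delta}\Big).$$ 2. For DIDS-F and DIDS-UCB, with probability at least $1-\alpha$, for all $T\ge1$, $$R_T\le C\,R\,\beta_T\sqrt{T\,\gamma_T}.$$ -/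

import Mathlib

open MeasureTheory ProbabilityTheory
open scoped ENNReal

noncomputable section

namespace FreqIDS

/-- Histories of length `t`: the actions and observations of the rounds `0, …, t - 1`.
Rounds are numbered from `0`, so round `t` is preceded by a history of length `t`. -/
abbrev Hist (X : Type*) (t : ℕ) : Type _ := Fin t → X × ℝ

/-- A policy maps each history, measurably, to a Borel probability measure on the action set. -/
structure Policy (X : Type*) [MeasurableSpace X] where
  dist : ∀ t : ℕ, Kernel (Hist X t) X
  isMarkov : ∀ t : ℕ, IsMarkovKernel (dist t)

/-- The history observed before round `t`. -/
def hist {X Ω : Type*} (x : ℕ → Ω → X) (y : ℕ → Ω → ℝ) (t : ℕ) (ω : Ω) : Hist X t :=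
  fun s => (x s ω, y s ω)

/-- `(x, y)` is a run of the policy `π` on the function `f` with noise process `ε`: given the
history, the action `x t` has distribution `π.dist t`, and `y t = f (x t) + ε t` is observed. -/
structure IsRun {X Ω : Type*} [MeasurableSpace X] [MeasurableSpace Ω] (P : Measure Ω)
    (f : X → ℝ) (π : Policy X) (x : ℕ → Ω → X) (y ε : ℕ → Ω → ℝ) : Prop where
  measurable_action : ∀ t, Measurable (x t)
  measurable_noise : ∀ t, Measurable (ε t)
  observation : ∀ t ω, y t ω = f (x t ω) + ε t ω
  action_law : ∀ t, P.map (fun ω => (hist x y t ω, x t ω)) = (P.map (hist x y t)) ⊗ₘ π.dist t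

/-- The sub-optimality gap `Δ(x) = max_{x'} f(x') - f(x)`. -/
def gap {X : Type*} (f : X → ℝ) (x : X) : ℝ := (⨆ x', f x') - f x

/-- The largest gap `S`. -/
def maxGap {X : Type*} (f : X → ℝ) : ℝ := ⨆ x, gap f x

/-- The regret `max_x ∑_t (f(x) - f(x_t))` over the first `T` rounds. -/
def regret {X Ω : Type*} (f : X → ℝ) (x : ℕ → Ω → X) (T : ℕ) (ω : Ω) : ℝ :=
  ⨆ x', ∑ t ∈ Finset.range T, (f x' - f (x t ω))

/-- Estimator sequences with symmetric confidence bounds `mean ± scale * width`; all three are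
computed from the history that precedes the round. -/
structure Estimator (X : Type*) [TopologicalSpace X] [MeasurableSpace X] where
  mean : ∀ t : ℕ, Hist X t → X → ℝ
  width : ∀ t : ℕ, Hist X t → X → ℝ
  scale : ∀ t : ℕ, Hist X t → ℝ
  continuous_mean : ∀ t h, Continuous (mean t h)
  continuous_width : ∀ t h, Continuous (width t h)
  measurable_mean : ∀ t x, Measurable (fun h => mean t h x)
  measurable_width : ∀ t x, Measurable (fun h => width t h x)
  measurable_scale : ∀ t, Measurable (scale t)
  width_nonneg : ∀ t h x, 0 ≤ width t h x
  scale_pos : ∀ t h, 0 < scale t h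

section Estimators

variable {X : Type*} [TopologicalSpace X] [MeasurableSpace X]

/-- Upper confidence bound. -/
def ucb (E : Estimator X) (t : ℕ) (h : Hist X t) (x : X) : ℝ :=
  E.mean t h x + E.scale t h * E.width t h x

/-- Lower confidence bound. -/
def lcb (E : Estimator X) (t : ℕ) (h : Hist X t) (x : X) : ℝ :=
  E.mean t h x - E.scale t h * E.width t h x

/-- The set of UCB actions. -/
def ucbSet (E : Estimator X) (t : ℕ) (h : Hist X t) : Set X :=
  {x | ∀ x', ucb E t h x' ≤ ucb E t h x}

/-- The surrogate `Δ_t^+(x) = max_{x'} ucb(x') - lcb(x)` of the gap. -/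
def gapPlus (E : Estimator X) (t : ℕ) (h : Hist X t) (x : X) : ℝ :=
  (⨆ x', ucb E t h x') - lcb E t h x

/-- The surrogate regret-information ratio `(𝔼_ν Δ_t^+)² / 𝔼_ν I_t`. In `ℝ≥0∞`, `0 / 0 = 0` and
`a / 0 = ∞` for `a > 0`. -/
def ratioPlus (E : Estimator X) (info : ∀ t : ℕ, Hist X t → X → ℝ) (t : ℕ) (h : Hist X t)
    (ν : Measure X) : ℝ≥0∞ :=
  ENNReal.ofReal ((∫ x, gapPlus E t h x ∂ν) ^ 2) / ENNReal.ofReal (∫ x, info t h x ∂ν)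

/-- Information directed sampling: every sampling distribution minimizes the surrogate ratio over
all probability measures on the action set. -/
def IsIDS (E : Estimator X) (info : ∀ t : ℕ, Hist X t → X → ℝ) (π : Policy X) : Prop :=
  ∀ (t : ℕ) (h : Hist X t) (ν : Measure X), IsProbabilityMeasure ν →
    ratioPlus E info t h (π.dist t h) ≤ ratioPlus E info t h ν

/-- Deterministic information directed sampling: the policy plays a single action, which minimizes
the surrogate ratio over all single actions. -/
def IsDIDS (E : Estimator X) (info : ∀ t : ℕ, Hist X t → X → ℝ) (π : Policy X) : Prop :=
  ∀ (t : ℕ) (h : Hist X t), ∃ a : X, π.dist t h = Measure.dirac a ∧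
    ∀ x : X, ratioPlus E info t h (Measure.dirac a) ≤ ratioPlus E info t h (Measure.dirac x)

/-- The information gain `I_t^F(x) = log (1 + σ_t(x)² / ρ(x)²)`. -/
def infoF (E : Estimator X) (ρ : X → ℝ) (t : ℕ) (h : Hist X t) (x : X) : ℝ :=
  Real.log (1 + E.width t h x ^ 2 / ρ x ^ 2)

/-- The information gain `I_t^UCB(x) = log (σ_t(u)² / σ_t(u|x)²)` for the UCB action `u = u_t`,
where `σ_t(u|x)` is the confidence width at `u` after `x` has been evaluated. It is used for the
least-squares widths below, which do not depend on the observed value, here set to `0`. -/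
def infoUCB (E : Estimator X) (u : ∀ t : ℕ, Hist X t → X) (t : ℕ) (h : Hist X t) (x : X) : ℝ :=
  Real.log (E.width t h (u t h) ^ 2 /
    E.width (t + 1) (Fin.snoc (α := fun _ => X × ℝ) h (x, 0)) (u t h) ^ 2)

/-- A measurable choice of UCB actions, taken with the smallest noise among the UCB actions. -/
structure IsUCBChoice (E : Estimator X) (ρ : X → ℝ) (u : ∀ t : ℕ, Hist X t → X) : Prop where
  measurable : ∀ t, Measurable (u t)
  mem : ∀ t h, u t h ∈ ucbSet E t h
  noise_le : ∀ t h, ∀ x ∈ ucbSet E t h, ρ (u t h) ≤ ρ x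

end Estimators

section LeastSquares

variable {X H : Type*} [NormedAddCommGroup H] [InnerProductSpace ℝ H]

/-- The operator `V_t = V₀ + ∑_s ρ(x_s)⁻² φ(x_s) ⊗ φ(x_s)` of regularized weighted least squares
with feature map `φ`. -/
def designOp (φ : X → H) (ρ : X → ℝ) (V₀ : H →L[ℝ] H) (t : ℕ) (h : Hist X t) : H →L[ℝ] H :=
  V₀ + ∑ s : Fin t, (ρ (h s).1 ^ 2)⁻¹ • (innerSL ℝ (φ (h s).1)).smulRight (φ (h s).1)

/-- The width `‖φ(x)‖_{V_t⁻¹}`. -/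
def lsWidth (φ : X → H) (ρ : X → ℝ) (V₀ : H →L[ℝ] H) (t : ℕ) (h : Hist X t) (x : X) : ℝ :=
  √(inner ℝ (φ x) (Ring.inverse (designOp φ ρ V₀ t h) (φ x)))

/-- The widths of `E` are those of regularized weighted least squares in the Hilbert space `H`, with
a continuous feature map `φ` and a positive definite (self-adjoint, invertible) regularizer `V₀`.
For `H = ℝᵈ`, `φ x = x` this is the linear case, for an RKHS `H` with continuous kernel `k` and
`φ x = k(x, ·)`, `V₀ = λ` it is the kernel case. -/
structure HasLeastSquaresWidth [TopologicalSpace X] [MeasurableSpace X] [CompleteSpace H]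
    (E : Estimator X) (ρ : X → ℝ) (φ : X → H) (V₀ : H →L[ℝ] H) : Prop where
  continuous_feature : Continuous φ
  isPositive : V₀.IsPositive
  isUnit : IsUnit V₀
  width_eq : ∀ t h x, E.width t h x = lsWidth φ ρ V₀ t h x

end LeastSquares

section Runs

variable {X Ω : Type*} [TopologicalSpace X] [MeasurableSpace X] [MeasurableSpace Ω]

/-- The property `Q` holds with probability at least `1 - p`. -/
def WithProb (P : Measure Ω) (p : ℝ) (Q : Ω → Prop) : Prop :=
  P {ω | ¬ Q ω} ≤ ENNReal.ofReal p

/-- With probability at least `1 - α`, the confidence bounds contain `f` everywhere, in all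
rounds. -/
def ConfidenceBounds (P : Measure Ω) (f : X → ℝ) (E : Estimator X) (x : ℕ → Ω → X)
    (y : ℕ → Ω → ℝ) (α : ℝ) : Prop :=
  WithProb P α fun ω => ∀ t a, |f a - E.mean t (hist x y t ω) a| ≤
    E.scale t (hist x y t ω) * E.width t (hist x y t ω) a

/-- The maximum information gain `γ_T`, the essential supremum of `∑_{t ≤ T} I_t(x_t)`. -/
def maxInfo (P : Measure Ω) (info : ∀ t : ℕ, Hist X t → X → ℝ) (x : ℕ → Ω → X)
    (y : ℕ → Ω → ℝ) (T : ℕ) : ℝ :=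
  essSup (fun ω => ∑ t ∈ Finset.range T, info t (hist x y t ω) (x t ω)) P

/-- Along the run, the information gains are at most `B`. -/
def InfoBounded (P : Measure Ω) (info : ∀ t : ℕ, Hist X t → X → ℝ) (x : ℕ → Ω → X)
    (y : ℕ → Ω → ℝ) (B : ℝ) : Prop :=
  ∀ᵐ ω ∂P, ∀ t a, info t (hist x y t ω) a ≤ B

/-- `R = sup_t min_{x ∈ X_t^UCB} ρ(x)`, along the run. -/
def noiseLevel (ρ : X → ℝ) (E : Estimator X) (x : ℕ → Ω → X) (y : ℕ → Ω → ℝ) (ω : Ω) : ℝ :=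
  ⨆ t : ℕ, ⨅ a : ucbSet E t (hist x y t ω), ρ a

/-- The scale factor `β_T` used in the `T`-th round (`T ≥ 1`), which has index `T - 1`. -/
def scaleAt (E : Estimator X) (x : ℕ → Ω → X) (y : ℕ → Ω → ℝ) (T : ℕ) (ω : Ω) : ℝ :=
  E.scale (T - 1) (hist x y (T - 1) ω)

/-- The regret bound for randomized policies: the bound for all large `T`, with the constant `C`,
and its form for all `T ≥ 1`, with the same constant and a lower-order term. -/
def RandomizedRegretBound (C α δ : ℝ) (P : Measure Ω) (f ρ : X → ℝ) (E : Estimator X)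
    (info : ∀ t : ℕ, Hist X t → X → ℝ) (x : ℕ → Ω → X) (y : ℕ → Ω → ℝ) : Prop :=
  (∃ T₀ : ℕ, WithProb P (α + δ) fun ω => ∀ T : ℕ, 1 ≤ T → T₀ ≤ T →
    regret f x T ω ≤ C * (noiseLevel ρ E x y ω * scaleAt E x y T ω *
      √(T * (maxInfo P info x y T + Real.log (1 / δ))))) ∧
  (WithProb P (α + δ) fun ω => ∀ T : ℕ, 1 ≤ T →
    regret f x T ω ≤ C * (noiseLevel ρ E x y ω * scaleAt E x y T ω *
      √(T * (maxInfo P info x y T + Real.log (2 / δ))) + maxGap f * Real.log (2 * T / δ)))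

/-- The regret bound for deterministic policies. -/
def DeterministicRegretBound (C α : ℝ) (P : Measure Ω) (f ρ : X → ℝ) (E : Estimator X)
    (info : ∀ t : ℕ, Hist X t → X → ℝ) (x : ℕ → Ω → X) (y : ℕ → Ω → ℝ) : Prop :=
  WithProb P α fun ω => ∀ T : ℕ, 1 ≤ T →
    regret f x T ω ≤ C * (noiseLevel ρ E x y ω * scaleAt E x y T ω *
      √(T * maxInfo P info x y T))

end Runs

end FreqIDS

end

set_option linter.unusedSectionVars false

namespace FreqIDS

/-! On the confidence event the gap is at most its surrogate (`gap_le_gapPlus`), so it suffices to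
bound the surrogate gaps. A minimizing policy is no worse than the Dirac measure at a UCB action `u`
of minimal noise. There the surrogate gap is the length `2βσ(u)` of the confidence interval and the
information is `log (1 + σ(u)²/ρ(u)²)`; for the UCB gain this is the Sherman-Morrison formula
(`infoUCB_self`). As the information is at most `B`, it is at least `exp (-B) σ(u)²/ρ(u)²`, so the
ratio is at most `4 exp B (ρ(u) β)²` (`exists_ratioPlus_dirac_le`). Hence each mean surrogate gap is
at most `2 exp (B/2) R β` times the root of the mean information, and Cauchy-Schwarz sums this over
the rounds (`sum_gapPlus_le`). `IsUCBInfo` isolates what both gains need.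

For DIDS the means are the realized values and nothing more is needed. For IDS, realized gaps are
compared with their conditional means, and conditional means of the information with its realized
values. Both comparisons lose a factor 2 and a logarithm, uniformly in time; they follow from
Ville's inequality for exponential supermartingales (`IsRun.withProb_sum_le`). -/

/-- The capital of a gambler who multiplies it by `m t h a` in each round and stops for good as soon
as it has reached `K`. -/
noncomputable def stoppedCapital {X : Type*} (m : ∀ t : ℕ, Hist X t → X → ℝ≥0∞) (K : ℝ≥0∞) :
    ∀ t : ℕ, Hist X t → ℝ≥0∞
  | 0, _ => 1
  | t + 1, h =>
    if K ≤ stoppedCapital m K t (Fin.init (α := fun _ => X × ℝ) h) then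
      stoppedCapital m K t (Fin.init (α := fun _ => X × ℝ) h)
    else stoppedCapital m K t (Fin.init (α := fun _ => X × ℝ) h) *
      m t (Fin.init (α := fun _ => X × ℝ) h) (h (Fin.last t)).1

/-! ### Pathwise behaviour of the stopped capital. -/

section StoppedCapital

variable {X Ω : Type*}

lemma init_hist (x : ℕ → Ω → X) (y : ℕ → Ω → ℝ) (t : ℕ) (ω : Ω) :
    Fin.init (α := fun _ => X × ℝ) (hist x y (t + 1) ω) = hist x y t ω := rfl

/-- The product may fall again after reaching `K`; the stopped capital does not, and thus records
that `K` was reached. -/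
lemma stoppedCapital_eq_or_le (m : ∀ t : ℕ, Hist X t → X → ℝ≥0∞) (K : ℝ≥0∞) (x : ℕ → Ω → X)
    (y : ℕ → Ω → ℝ) (ω : Ω) (t : ℕ) :
    (stoppedCapital m K t (hist x y t ω) =
      ∏ s ∈ Finset.range t, m s (hist x y s ω) (x s ω)) ∨
    K ≤ stoppedCapital m K t (hist x y t ω) := by
  induction t with
  | zero => simp [stoppedCapital]
  | succ t ih =>
    by_cases h : K ≤ stoppedCapital m K t (hist x y t ω)
    · right
      simp [stoppedCapital, init_hist, h]
    · left
      rw [Finset.prod_range_succ, ← ih.resolve_right h]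
      simp [stoppedCapital, init_hist, h, hist]

lemma stoppedCapital_reached_mono (m : ∀ t : ℕ, Hist X t → X → ℝ≥0∞) (K : ℝ≥0∞) (x : ℕ → Ω → X)
    (y : ℕ → Ω → ℝ) : Monotone fun t => {ω | K ≤ stoppedCapital m K t (hist x y t ω)} := by
  refine monotone_nat_of_le_succ fun t ω h => ?_
  have h' : K ≤ stoppedCapital m K t (hist x y t ω) := h
  simp [stoppedCapital, init_hist, h']

end StoppedCapital

/-! ### Ville's inequality and time-uniform concentration along a run. -/

section Ville

variable {X Ω : Type*} [MeasurableSpace X] [MeasurableSpace Ω]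

lemma measurable_init (t : ℕ) :
    Measurable (fun h : Hist X (t + 1) => (Fin.init (α := fun _ => X × ℝ) h : Hist X t)) :=
  measurable_pi_lambda _ fun _ => measurable_pi_apply _

lemma measurable_stoppedCapital {m : ∀ t : ℕ, Hist X t → X → ℝ≥0∞}
    (hm : ∀ t, Measurable (Function.uncurry (m t))) (K : ℝ≥0∞) (t : ℕ) :
    Measurable (stoppedCapital m K t) := by
  induction t with
  | zero => exact measurable_const
  | succ t ih =>
    have h1 := ih.comp (measurable_init (X := X) t)
    refine Measurable.ite (measurableSet_le measurable_const h1) h1 (h1.mul ?_)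
    exact (hm t).comp ((measurable_init t).prodMk (measurable_pi_apply (Fin.last t)).fst)

variable {P : Measure Ω} {f : X → ℝ} {π : Policy X} {x : ℕ → Ω → X} {y ε : ℕ → Ω → ℝ}

lemma IsRun.measurable_hist (hr : IsRun P f π x y ε) (hf : Measurable f) (t : ℕ) :
    Measurable (hist x y t) := by
  refine measurable_pi_lambda _ fun s => (hr.measurable_action s).prodMk ?_
  have : y s = fun ω => f (x s ω) + ε s ω := funext (hr.observation s)
  rw [this]
  exact (hf.comp (hr.measurable_action s)).add (hr.measurable_noise s)

/-- Disintegration of the law of the history and the next action. -/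
lemma IsRun.lintegral_eq [IsProbabilityMeasure P] (hr : IsRun P f π x y ε) (hf : Measurable f)
    (t : ℕ) {g : Hist X t × X → ℝ≥0∞} (hg : Measurable g) :
    ∫⁻ ω, g (hist x y t ω, x t ω) ∂P = ∫⁻ ω, ∫⁻ a, g (hist x y t ω, a) ∂π.dist t (hist x y t ω) ∂P := by
  have := π.isMarkov t
  have hh := hr.measurable_hist hf t
  rw [← lintegral_map (f := g) hg (hh.prodMk (hr.measurable_action t)), hr.action_law t,
    Measure.lintegral_compProd hg,
    lintegral_map (f := fun h => ∫⁻ a, g (h, a) ∂π.dist t h) hg.lintegral_kernel_prod_right' hh]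

/-- Supermartingale property: integrating out the last action against the policy multiplies the
capital by at most 1. -/
lemma lintegral_stoppedCapital_le [IsProbabilityMeasure P] (hr : IsRun P f π x y ε)
    (hf : Measurable f) {m : ∀ t : ℕ, Hist X t → X → ℝ≥0∞}
    (hm : ∀ t, Measurable (Function.uncurry (m t)))
    (hm1 : ∀ t h, ∫⁻ a, m t h a ∂π.dist t h ≤ 1) (K : ℝ≥0∞) (t : ℕ) :
    ∫⁻ ω, stoppedCapital m K t (hist x y t ω) ∂P ≤ 1 := by
  induction t with
  | zero => simp [stoppedCapital]
  | succ t ih =>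
    refine le_trans ?_ ih
    have hc := (measurable_stoppedCapital hm K t).comp
      (measurable_fst : Measurable (Prod.fst : Hist X t × X → Hist X t))
    have key := hr.lintegral_eq hf t
      (g := fun p => if K ≤ stoppedCapital m K t p.1 then stoppedCapital m K t p.1
        else stoppedCapital m K t p.1 * m t p.1 p.2)
      (Measurable.ite (measurableSet_le measurable_const hc) hc (hc.mul (hm t)))
    change ∫⁻ ω, (if K ≤ stoppedCapital m K t (hist x y t ω) then
      stoppedCapital m K t (hist x y t ω) else
      stoppedCapital m K t (hist x y t ω) * m t (hist x y t ω) (x t ω)) ∂P ≤ _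
    rw [key]
    refine lintegral_mono fun ω => ?_
    have := π.isMarkov t
    by_cases h : K ≤ stoppedCapital m K t (hist x y t ω)
    · simp [h]
    · simp only [h, if_false]
      have hmt : Measurable (m t (hist x y t ω)) := (hm t).comp measurable_prodMk_left
      rw [lintegral_const_mul _ hmt]
      exact mul_le_of_le_one_right' (hm1 t _)

/-- Ville's maximal inequality along a run. -/
theorem IsRun.ville [IsProbabilityMeasure P] (hr : IsRun P f π x y ε)
    (hf : Measurable f) {m : ∀ t : ℕ, Hist X t → X → ℝ≥0∞}
    (hm : ∀ t, Measurable (Function.uncurry (m t)))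
    (hm1 : ∀ t h, ∫⁻ a, m t h a ∂π.dist t h ≤ 1) (K : ℝ≥0∞) :
    P {ω | ∃ T, K ≤ ∏ s ∈ Finset.range T, m s (hist x y s ω) (x s ω)} ≤ K⁻¹ := by
  have hsub : {ω | ∃ T, K ≤ ∏ s ∈ Finset.range T, m s (hist x y s ω) (x s ω)} ⊆
      ⋃ T, {ω | K ≤ stoppedCapital m K T (hist x y T ω)} := by
    rintro ω ⟨T, hT⟩
    refine Set.mem_iUnion.2 ⟨T, ?_⟩
    rcases stoppedCapital_eq_or_le m K x y ω T with h | h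
    · rwa [← h] at hT
    · exact h
  refine (measure_mono hsub).trans ?_
  -- The union is increasing, so Markov's inequality at each single time suffices.
  rw [(stoppedCapital_reached_mono m K x y).measure_iUnion]
  refine iSup_le fun T => ?_
  have := (mul_meas_ge_le_lintegral₀ (μ := P) ((measurable_stoppedCapital hm K T).comp
    (hr.measurable_hist hf T)).aemeasurable K).trans
    (lintegral_stoppedCapital_le hr hf hm hm1 K T)
  rw [ENNReal.le_inv_iff_mul_le, mul_comm]
  exact this

/-- If `exp w ≤ 1 + c * g` pointwise, then the sum of the `w t` along a run exceeds `c` times the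
sum of the conditional expectations of `g t` by at most `log (1 / δ)`, at all times, with
probability at least `1 - δ`. -/
theorem IsRun.withProb_sum_le [IsProbabilityMeasure P] (hr : IsRun P f π x y ε)
    (hf : Measurable f) {w g : ∀ t : ℕ, Hist X t → X → ℝ} {c δ : ℝ} (hδ : 0 < δ)
    (hw : ∀ t, Measurable (Function.uncurry (w t))) (hg : ∀ t, Measurable (Function.uncurry (g t)))
    (hg0 : ∀ t h a, 0 ≤ g t h a) (hg1 : ∀ t h a, g t h a ≤ 1)
    (hwg : ∀ t h a, Real.exp (w t h a) ≤ 1 + c * g t h a) :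
    WithProb P δ fun ω => ∀ T : ℕ, ∑ t ∈ Finset.range T, w t (hist x y t ω) (x t ω) ≤
      c * ∑ t ∈ Finset.range T, ∫ a, g t (hist x y t ω) a ∂π.dist t (hist x y t ω) +
        Real.log (1 / δ) := by
  -- With `A` the conditional mean of `g`, these factors have conditional mean at most `(1 + c A)
  -- exp (-c A) ≤ 1`.
  let m : ∀ t : ℕ, Hist X t → X → ℝ≥0∞ := fun t h a =>
    ENNReal.ofReal (Real.exp (w t h a - c * ∫ b, g t h b ∂π.dist t h))
  have hm : ∀ t, Measurable (Function.uncurry (m t)) := fun t => by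
    have := π.isMarkov t
    have h1 : Measurable fun h => ∫ b, g t h b ∂π.dist t h :=
      ((hg t).stronglyMeasurable.integral_kernel_prod_right (f := g t)).measurable
    exact (((hw t).sub ((h1.comp measurable_fst).const_mul c)).exp).ennreal_ofReal
  have hm1 : ∀ t h, ∫⁻ a, m t h a ∂π.dist t h ≤ 1 := fun t h => by
    have := π.isMarkov t
    have hgm : Measurable (g t h) := (hg t).comp measurable_prodMk_left
    have hgi : Integrable (g t h) (π.dist t h) :=
      Integrable.of_bound hgm.aestronglyMeasurable 1 (Filter.Eventually.of_forall fun a => by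
        rw [Real.norm_eq_abs, abs_of_nonneg (hg0 t h a)]; exact hg1 t h a)
    set A := ∫ b, g t h b ∂π.dist t h
    have hpos : ∀ a, 0 ≤ (1 + c * g t h a) * Real.exp (-(c * A)) := fun a =>
      mul_nonneg ((Real.exp_pos _).le.trans (hwg t h a)) (Real.exp_pos _).le
    have hint : Integrable (fun a => (1 + c * g t h a) * Real.exp (-(c * A))) (π.dist t h) :=
      ((integrable_const 1).add (hgi.const_mul c)).mul_const _
    calc ∫⁻ a, m t h a ∂π.dist t h
        ≤ ∫⁻ a, ENNReal.ofReal ((1 + c * g t h a) * Real.exp (-(c * A))) ∂π.dist t h := by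
          refine lintegral_mono fun a => ENNReal.ofReal_le_ofReal ?_
          rw [sub_eq_add_neg, Real.exp_add]
          exact mul_le_mul_of_nonneg_right (hwg t h a) (Real.exp_pos _).le
      _ = ENNReal.ofReal ((1 + c * A) * Real.exp (-(c * A))) := by
          rw [← ofReal_integral_eq_lintegral_ofReal hint (Filter.Eventually.of_forall hpos),
            integral_mul_const, integral_add (integrable_const 1) (hgi.const_mul c),
            integral_const_mul]
          simp [A]
      _ ≤ 1 := by
          rw [ENNReal.ofReal_le_one]
          calc (1 + c * A) * Real.exp (-(c * A))
              ≤ Real.exp (c * A) * Real.exp (-(c * A)) :=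
                mul_le_mul_of_nonneg_right (by linarith [Real.add_one_le_exp (c * A)])
                  (Real.exp_pos _).le
            _ = 1 := by rw [← Real.exp_add]; simp
  have hv := hr.ville hf hm hm1 (ENNReal.ofReal (1 / δ))
  rw [← ENNReal.ofReal_inv_of_pos (by positivity), one_div, inv_inv] at hv
  refine (measure_mono ?_).trans hv
  intro ω hω
  simp only [Set.mem_ofPred_eq, not_forall, not_le] at hω ⊢
  obtain ⟨T, hT⟩ := hω
  refine ⟨T, ?_⟩
  rw [← ENNReal.ofReal_prod_of_nonneg (fun _ _ => (Real.exp_pos _).le), ← Real.exp_sum]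
  refine ENNReal.ofReal_le_ofReal ?_
  rw [Finset.sum_sub_distrib, ← Finset.mul_sum, ← one_div, ← Real.exp_log (one_div_pos.2 hδ)]
  exact Real.exp_le_exp.2 (by linarith)

/-- The sum of nonnegative, bounded functions along a run is at most twice the sum of their
conditional expectations, up to a constant. -/
theorem IsRun.withProb_sum_le_condExp [IsProbabilityMeasure P] (hr : IsRun P f π x y ε)
    (hf : Measurable f) {g : ∀ t : ℕ, Hist X t → X → ℝ} {b δ : ℝ} (hb : 0 ≤ b) (hδ : 0 < δ)
    (hg : ∀ t, Measurable (Function.uncurry (g t)))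
    (hg0 : ∀ t h a, 0 ≤ g t h a) (hg1 : ∀ t h a, g t h a ≤ b) :
    WithProb P δ fun ω => ∀ T : ℕ, ∑ t ∈ Finset.range T, g t (hist x y t ω) (x t ω) ≤
      2 * ∑ t ∈ Finset.range T, ∫ a, g t (hist x y t ω) a ∂π.dist t (hist x y t ω) +
        b * Real.log (1 / δ) := by
  rcases hb.eq_or_lt with rfl | hb
  · have h0 : ∀ t h a, g t h a = 0 := fun t h a => le_antisymm (hg1 t h a) (hg0 t h a)
    simp [WithProb, h0]
  have h1 : ∀ t h a, g t h a / b ≤ 1 := fun t h a => (div_le_one hb).2 (hg1 t h a)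
  have h0 : ∀ t h a, 0 ≤ g t h a / b := fun t h a => div_nonneg (hg0 t h a) hb.le
  -- `exp z ≤ 1 + 2z` on `[0, 1]`.
  have := hr.withProb_sum_le hf (w := fun t h a => g t h a / b) (g := fun t h a => g t h a / b)
    (c := 2) hδ (fun t => (hg t).div_const b) (fun t => (hg t).div_const b) h0 h1 (fun t h a => by
      have := Real.abs_exp_sub_one_le (x := g t h a / b) (by
        rw [abs_of_nonneg (h0 t h a)]; exact h1 t h a)
      rw [abs_of_nonneg (h0 t h a)] at this
      linarith [le_abs_self (Real.exp (g t h a / b) - 1)])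
  refine (measure_mono fun ω hω => ?_).trans this
  simp only [Set.mem_ofPred_eq, not_forall, not_le, integral_div, ← Finset.sum_div] at hω ⊢
  obtain ⟨T, hT⟩ := hω
  refine ⟨T, ?_⟩
  rw [lt_div_iff₀ hb, add_mul, mul_div_assoc', div_mul_cancel₀ _ hb.ne', mul_comm (Real.log _)]
  exact hT

/-- The sum of the conditional expectations of nonnegative, bounded functions along a run is at
most twice the sum of their values, up to a constant. -/
theorem IsRun.withProb_condExp_sum_le [IsProbabilityMeasure P] (hr : IsRun P f π x y ε)
    (hf : Measurable f) {g : ∀ t : ℕ, Hist X t → X → ℝ} {b δ : ℝ} (hb : 0 < b) (hδ : 0 < δ)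
    (hg : ∀ t, Measurable (Function.uncurry (g t)))
    (hg0 : ∀ t h a, 0 ≤ g t h a) (hg1 : ∀ t h a, g t h a ≤ b) :
    WithProb P δ fun ω => ∀ T : ℕ,
      ∑ t ∈ Finset.range T, ∫ a, g t (hist x y t ω) a ∂π.dist t (hist x y t ω) ≤
      2 * ∑ t ∈ Finset.range T, g t (hist x y t ω) (x t ω) + 2 * b * Real.log (1 / δ) := by
  have h1 : ∀ t h a, g t h a / b ≤ 1 := fun t h a => (div_le_one hb).2 (hg1 t h a)
  have h0 : ∀ t h a, 0 ≤ g t h a / b := fun t h a => div_nonneg (hg0 t h a) hb.le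
  -- `exp (-z) ≤ 1 - z/2` on `[0, 1]`, because `(1 + z)(1 - z/2) ≥ 1` there.
  have := hr.withProb_sum_le hf (w := fun t h a => -(g t h a / b)) (g := fun t h a => g t h a / b)
    (c := -(1 / 2)) hδ (fun t => ((hg t).div_const b).neg) (fun t => (hg t).div_const b) h0 h1
    (fun t h a => by
      have h0 := h0 t h a
      have h1 := h1 t h a
      set z := g t h a / b
      rw [Real.exp_neg]
      refine inv_le_of_inv_le₀ (by linarith) ?_
      refine le_trans ?_ (Real.add_one_le_exp z)
      rw [inv_le_iff_one_le_mul₀ (by linarith)]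
      nlinarith)
  refine (measure_mono fun ω hω => ?_).trans this
  simp only [Set.mem_ofPred_eq, not_forall, not_le, integral_div, ← Finset.sum_div,
    Finset.sum_neg_distrib] at hω ⊢
  obtain ⟨T, hT⟩ := hω
  refine ⟨T, ?_⟩
  have e : ∀ G V L : ℝ, 2 * G + 2 * b * L < V → -(1 / 2) * (V / b) + L < -(G / b) := by
    intro G V L h
    have : -(G / b) - (-(1 / 2) * (V / b) + L) = (V - (2 * G + 2 * b * L)) / (2 * b) := by
      field_simp; ring
    have : 0 < (V - (2 * G + 2 * b * L)) / (2 * b) := div_pos (by linarith) (by linarith)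
    linarith
  exact e _ _ _ hT

end Ville

/-! ### Rank-one updates of positive invertible operators. -/

section RankOne

variable {H : Type*} [NormedAddCommGroup H] [InnerProductSpace ℝ H]

lemma isPositive_add_rankOne {V : H →L[ℝ] H} (hV : V.IsPositive) {c : ℝ} (hc : 0 ≤ c) (v : H) :
    (V + c • (innerSL ℝ v).smulRight v).IsPositive := by
  refine hV.add ⟨fun a b => ?_, fun a => ?_⟩
  · simp [inner_smul_left, inner_smul_right, real_inner_comm]
    left
    ring
  · simp only [ContinuousLinearMap.reApplyInnerSelf_apply, smul_apply,
      ContinuousLinearMap.smulRight_apply, innerSL_apply_apply, inner_smul_left]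
    simp only [conj_trivial, RCLike.re_to_real]
    exact mul_nonneg hc (mul_self_nonneg _)

lemma inner_ringInverse_comm {V : H →L[ℝ] H} (hV : V.IsPositive) (hu : IsUnit V) (a b : H) :
    inner ℝ (Ring.inverse V a) b = inner ℝ a (Ring.inverse V b) := by
  have e : ∀ z, V (Ring.inverse V z) = z := fun z => by
    rw [← mul_apply_eq_comp, Ring.mul_inverse_cancel _ hu]; rfl
  calc inner ℝ (Ring.inverse V a) b = inner ℝ (Ring.inverse V a) (V (Ring.inverse V b)) := by rw [e]
    _ = inner ℝ (V (Ring.inverse V a)) (Ring.inverse V b) := (hV.1 _ _).symm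
    _ = _ := by rw [e]

lemma inner_ringInverse_nonneg {V : H →L[ℝ] H} (hV : V.IsPositive) (hu : IsUnit V) (a : H) :
    0 ≤ inner ℝ a (Ring.inverse V a) := by
  have e : V (Ring.inverse V a) = a := by
    rw [← mul_apply_eq_comp, Ring.mul_inverse_cancel _ hu]; rfl
  calc 0 ≤ inner ℝ (V (Ring.inverse V a)) (Ring.inverse V a) := hV.inner_nonneg_left _
    _ = _ := by rw [e]

/-- The Sherman-Morrison formula. -/
lemma ringInverse_add_rankOne {V : H →L[ℝ] H} (hV : V.IsPositive) (hu : IsUnit V) {c : ℝ}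
    (hc : 0 ≤ c) (v : H) :
    IsUnit (V + c • (innerSL ℝ v).smulRight v) ∧
    ∀ z, Ring.inverse (V + c • (innerSL ℝ v).smulRight v) z = Ring.inverse V z -
      (c * inner ℝ v (Ring.inverse V z) / (1 + c * inner ℝ v (Ring.inverse V v))) •
        Ring.inverse V v := by
  have hq := inner_ringInverse_nonneg hV hu v
  set q := inner ℝ v (Ring.inverse V v) with hqdef
  have hd : 1 + c * q ≠ 0 := by positivity
  set W := V + c • (innerSL ℝ v).smulRight v with hW
  -- The candidate inverse. Both products are checked, since in infinite dimension a one-sided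
  -- inverse is not enough.
  set U : H →L[ℝ] H := Ring.inverse V - (c / (1 + c * q)) •
    (innerSL ℝ (Ring.inverse V v)).smulRight (Ring.inverse V v) with hU
  have eV : ∀ z, V (Ring.inverse V z) = z := fun z => by
    rw [← mul_apply_eq_comp, Ring.mul_inverse_cancel _ hu]; rfl
  have eV' : ∀ z, Ring.inverse V (V z) = z := fun z => by
    rw [← mul_apply_eq_comp, Ring.inverse_mul_cancel _ hu]; rfl
  have hUz : ∀ z, U z = Ring.inverse V z -
      (c * inner ℝ v (Ring.inverse V z) / (1 + c * q)) • Ring.inverse V v := fun z => by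
    simp only [hU, sub_apply, smul_apply,
      ContinuousLinearMap.smulRight_apply, innerSL_apply_apply, smul_smul,
      inner_ringInverse_comm hV hu]
    congr 2
    ring
  have hWz : ∀ z, W z = V z + (c * inner ℝ v z) • v := fun z => by
    simp [hW, smul_smul]
  have h1 : W * U = 1 := by
    ext z
    rw [mul_apply_eq_comp, hWz, hUz, map_sub, map_smul, eV, eV, inner_sub_right,
      inner_smul_right, ← hqdef, one_apply_eq_self, sub_add, ← sub_smul]
    have : c * inner ℝ v (Ring.inverse V z) / (1 + c * q) -
        c * (inner ℝ v (Ring.inverse V z) -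
          c * inner ℝ v (Ring.inverse V z) / (1 + c * q) * q) = 0 := by
      field_simp; ring
    rw [this, zero_smul, sub_zero]
  have h2 : U * W = 1 := by
    ext z
    have e2 : inner ℝ v (Ring.inverse V (V z + (c * inner ℝ v z) • v)) =
        inner ℝ v z + c * inner ℝ v z * q := by
      rw [map_add, map_smul, eV', inner_add_right, inner_smul_right]
    rw [mul_apply_eq_comp, hUz, hWz, e2, map_add, map_smul, eV',
      one_apply_eq_self, add_sub_assoc, ← sub_smul]
    have : c * inner ℝ v z - c * (inner ℝ v z + c * inner ℝ v z * q) / (1 + c * q) = 0 := by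
      field_simp; ring
    rw [this, zero_smul, add_zero]
  have hWu : IsUnit W := ⟨⟨W, U, h1, h2⟩, rfl⟩
  refine ⟨hWu, fun z => ?_⟩
  have : Ring.inverse W = U := Ring.inverse_unit (⟨W, U, h1, h2⟩ : (H →L[ℝ] H)ˣ)
  rw [this, hUz]

end RankOne

/-! ### Least-squares widths and the UCB information gain. -/

section LeastSquares

variable {X H : Type*} [NormedAddCommGroup H] [InnerProductSpace ℝ H]

lemma designOp_succ (φ : X → H) (ρ : X → ℝ) (V₀ : H →L[ℝ] H) (t : ℕ) (h : Hist X (t + 1)) :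
    designOp φ ρ V₀ (t + 1) h =
      designOp φ ρ V₀ t (Fin.init (α := fun _ => X × ℝ) h) +
        (ρ (h (Fin.last t)).1 ^ 2)⁻¹ •
          (innerSL ℝ (φ (h (Fin.last t)).1)).smulRight (φ (h (Fin.last t)).1) := by
  rw [designOp, designOp, Fin.sum_univ_castSucc, ← add_assoc]
  rfl

lemma designOp_snoc (φ : X → H) (ρ : X → ℝ) (V₀ : H →L[ℝ] H) (t : ℕ) (h : Hist X t) (p : X × ℝ) :
    designOp φ ρ V₀ (t + 1) (Fin.snoc (α := fun _ => X × ℝ) h p) =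
      designOp φ ρ V₀ t h + (ρ p.1 ^ 2)⁻¹ • (innerSL ℝ (φ p.1)).smulRight (φ p.1) := by
  rw [designOp_succ, Fin.init_snoc, Fin.snoc_last]

lemma designOp_isPositive_isUnit (φ : X → H) (ρ : X → ℝ) {V₀ : H →L[ℝ] H} (hV : V₀.IsPositive)
    (hu : IsUnit V₀) (t : ℕ) (h : Hist X t) :
    (designOp φ ρ V₀ t h).IsPositive ∧ IsUnit (designOp φ ρ V₀ t h) := by
  induction t with
  | zero => simpa [designOp] using ⟨hV, hu⟩
  | succ t ih =>
    obtain ⟨h1, h2⟩ := ih (Fin.init (α := fun _ => X × ℝ) h)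
    rw [designOp_succ]
    exact ⟨isPositive_add_rankOne h1 (by positivity) _,
      (ringInverse_add_rankOne h1 h2 (by positivity) _).1⟩

lemma lsWidth_sq (φ : X → H) (ρ : X → ℝ) {V₀ : H →L[ℝ] H} (hV : V₀.IsPositive)
    (hu : IsUnit V₀) (t : ℕ) (h : Hist X t) (a : X) :
    lsWidth φ ρ V₀ t h a ^ 2 = inner ℝ (φ a) (Ring.inverse (designOp φ ρ V₀ t h) (φ a)) :=
  Real.sq_sqrt (inner_ringInverse_nonneg (designOp_isPositive_isUnit φ ρ hV hu t h).1
    (designOp_isPositive_isUnit φ ρ hV hu t h).2 _)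

/-- Update of the squared width by one evaluation. -/
lemma lsWidth_sq_snoc (φ : X → H) (ρ : X → ℝ) {V₀ : H →L[ℝ] H} (hV : V₀.IsPositive)
    (hu : IsUnit V₀) (t : ℕ) (h : Hist X t) (p : X × ℝ) (a : X) :
    lsWidth φ ρ V₀ (t + 1) (Fin.snoc (α := fun _ => X × ℝ) h p) a ^ 2 =
      lsWidth φ ρ V₀ t h a ^ 2 - (ρ p.1 ^ 2)⁻¹ *
        inner ℝ (φ p.1) (Ring.inverse (designOp φ ρ V₀ t h) (φ a)) ^ 2 /
          (1 + (ρ p.1 ^ 2)⁻¹ * lsWidth φ ρ V₀ t h p.1 ^ 2) := by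
  obtain ⟨h1, h2⟩ := designOp_isPositive_isUnit φ ρ hV hu t h
  rw [lsWidth_sq φ ρ hV hu, lsWidth_sq φ ρ hV hu, lsWidth_sq φ ρ hV hu, designOp_snoc,
    (ringInverse_add_rankOne h1 h2 (by positivity) _).2, inner_sub_right, inner_smul_right,
    ← inner_ringInverse_comm h1 h2 (φ a) (φ p.1),
    real_inner_comm (φ p.1) (Ring.inverse (designOp φ ρ V₀ t h) (φ a))]
  ring

/-- An evaluation can only shrink the width: the update subtracts a nonnegative term. -/
lemma infoUCB_nonneg [TopologicalSpace X] [MeasurableSpace X] [CompleteSpace H]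
    {E : Estimator X} {ρ : X → ℝ} {φ : X → H} {V₀ : H →L[ℝ] H}
    (hE : HasLeastSquaresWidth E ρ φ V₀) (u : ∀ t : ℕ, Hist X t → X) (t : ℕ) (h : Hist X t)
    (a : X) : 0 ≤ infoUCB E u t h a := by
  rw [infoUCB]
  have key : E.width (t + 1) (Fin.snoc (α := fun _ => X × ℝ) h (a, 0)) (u t h) ^ 2 ≤
      E.width t h (u t h) ^ 2 := by
    rw [hE.width_eq, hE.width_eq, lsWidth_sq_snoc φ ρ hE.isPositive hE.isUnit]
    exact sub_le_self _ (by positivity)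
  rcases (sq_nonneg (E.width (t + 1) (Fin.snoc (α := fun _ => X × ℝ) h (a, 0)) (u t h))).eq_or_lt
    with h0 | h0
  -- If the updated width vanishes, the gain is `log 0 = 0` by the conventions for division and
  -- logarithm.
  · rw [← h0]; simp
  · exact Real.log_nonneg ((one_le_div h0).2 key)

/-- At the UCB action itself, the two information gains agree. -/
lemma infoUCB_self [TopologicalSpace X] [MeasurableSpace X] [CompleteSpace H]
    {E : Estimator X} {ρ : X → ℝ} {φ : X → H} {V₀ : H →L[ℝ] H}
    (hE : HasLeastSquaresWidth E ρ φ V₀) (u : ∀ t : ℕ, Hist X t → X) (t : ℕ) (h : Hist X t) :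
    infoUCB E u t h (u t h) = infoF E ρ t h (u t h) := by
  rw [infoUCB, infoF]
  have key : E.width (t + 1) (Fin.snoc (α := fun _ => X × ℝ) h (u t h, 0)) (u t h) ^ 2 =
      E.width t h (u t h) ^ 2 / (1 + E.width t h (u t h) ^ 2 / ρ (u t h) ^ 2) := by
    rw [hE.width_eq, hE.width_eq, lsWidth_sq_snoc φ ρ hE.isPositive hE.isUnit,
      ← lsWidth_sq φ ρ hE.isPositive hE.isUnit]
    dsimp only
    have hc : 0 ≤ (ρ (u t h) ^ 2)⁻¹ := by positivity
    rw [div_eq_mul_inv (lsWidth φ ρ V₀ t h (u t h) ^ 2) (ρ (u t h) ^ 2)]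
    generalize (ρ (u t h) ^ 2)⁻¹ = c at hc ⊢
    have : (1 + lsWidth φ ρ V₀ t h (u t h) ^ 2 * c) ≠ 0 := by positivity
    have : (1 + c * lsWidth φ ρ V₀ t h (u t h) ^ 2) ≠ 0 := by positivity
    field_simp
    ring
  rw [key]
  by_cases h0 : E.width t h (u t h) ^ 2 = 0
  -- At width zero both gains are 0, one as `log 0` and the other as `log 1`.
  · simp [h0]
  · rw [div_div_cancel₀ h0]

end LeastSquares

/-! ### Joint measurability of the information gains. -/

section Measurability

variable {X : Type*} [MetricSpace X] [CompactSpace X] [MeasurableSpace X] [BorelSpace X]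

/-- Carathéodory function: measurable in the history, continuous in the action. -/
lemma Estimator.measurable_uncurry_width (E : Estimator X) (t : ℕ) :
    Measurable (Function.uncurry (E.width t)) :=
  (measurable_uncurry_of_continuous_of_measurable (u := fun a h => E.width t h a)
    (fun h => E.continuous_width t h) (fun a => E.measurable_width t a)).comp measurable_swap

lemma measurable_infoF (E : Estimator X) {ρ : X → ℝ} (hρ : Measurable ρ) (t : ℕ) :
    Measurable (Function.uncurry (infoF E ρ t)) :=
  (((E.measurable_uncurry_width t).pow_const 2).div
    ((hρ.comp measurable_snd).pow_const 2)).const_add 1 |>.log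

lemma measurable_infoUCB (E : Estimator X) {u : ∀ t : ℕ, Hist X t → X}
    (hu : ∀ t, Measurable (u t)) (t : ℕ) :
    Measurable (Function.uncurry (infoUCB E u t)) := by
  have hu' : Measurable fun p : Hist X t × X => u t p.1 := (hu t).comp measurable_fst
  have hs : Measurable fun p : Hist X t × X =>
      (Fin.snoc (α := fun _ => X × ℝ) p.1 (p.2, 0) : Hist X (t + 1)) := by
    refine measurable_pi_lambda _ fun i => ?_
    refine Fin.lastCases ?_ (fun i => ?_) i
    · simpa using measurable_snd.prodMk measurable_const
    · simp only [Fin.snoc_castSucc]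
      exact (measurable_pi_apply i).comp measurable_fst
  exact ((((E.measurable_uncurry_width t).comp (measurable_fst.prodMk hu')).pow_const 2).div
    (((E.measurable_uncurry_width (t + 1)).comp (hs.prodMk hu')).pow_const 2)).log

end Measurability

/-- Information gains that agree with `infoF` at some UCB action of minimal noise. -/
structure IsUCBInfo {X : Type*} [TopologicalSpace X] [MeasurableSpace X] (E : Estimator X)
    (ρ : X → ℝ) (info : ∀ t : ℕ, Hist X t → X → ℝ) : Prop where
  measurable : ∀ t, Measurable (Function.uncurry (info t))
  nonneg : ∀ t h a, 0 ≤ info t h a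
  exists_ucb : ∀ t h, ∃ u ∈ ucbSet E t h, (∀ a ∈ ucbSet E t h, ρ u ≤ ρ a) ∧
    info t h u = infoF E ρ t h u

section Continuity

variable {X : Type*} [TopologicalSpace X]

lemma continuous_gap {f : X → ℝ} (hf : Continuous f) : Continuous (gap f) :=
    continuous_const.sub hf

variable [MeasurableSpace X] (E : Estimator X) (t : ℕ) (h : Hist X t)

lemma continuous_ucb : Continuous (ucb E t h) :=
  (E.continuous_mean t h).add (continuous_const.mul (E.continuous_width t h))

lemma continuous_lcb : Continuous (lcb E t h) :=
  (E.continuous_mean t h).sub (continuous_const.mul (E.continuous_width t h))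

lemma continuous_gapPlus : Continuous (gapPlus E t h) := continuous_const.sub (continuous_lcb E t h)

end Continuity

/-! ### Gaps, surrogate gaps and the noise level. -/

section Gap

variable {X : Type*} [MetricSpace X] [CompactSpace X] {f : X → ℝ}

lemma gap_nonneg (hf : Continuous f) (a : X) : 0 ≤ gap f a :=
  sub_nonneg.2 (le_ciSup (isCompact_range hf).bddAbove a)

lemma gap_le_maxGap (hf : Continuous f) (a : X) : gap f a ≤ maxGap f :=
  le_ciSup (isCompact_range (continuous_gap hf)).bddAbove a

lemma regret_le_sum_gap [Nonempty X] {Ω : Type*} (hf : Continuous f) (x : ℕ → Ω → X) (T : ℕ)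
    (ω : Ω) : regret f x T ω ≤ ∑ t ∈ Finset.range T, gap f (x t ω) :=
  ciSup_le fun a => Finset.sum_le_sum fun _ _ =>
    sub_le_sub_right (le_ciSup (isCompact_range hf).bddAbove a) _

variable [MeasurableSpace X] (E : Estimator X) (t : ℕ) (h : Hist X t)

/-- The upper bound replaces `f` in the maximum, the lower bound replaces `f a`. -/
lemma gap_le_gapPlus [Nonempty X]
    (hc : ∀ a, |f a - E.mean t h a| ≤ E.scale t h * E.width t h a) (a : X) :
    gap f a ≤ gapPlus E t h a := by
  refine sub_le_sub (ciSup_mono (isCompact_range (continuous_ucb E t h)).bddAbove fun b => ?_) ?_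
  · have := (abs_le.1 (hc b)).2
    unfold ucb
    linarith
  · have := (abs_le.1 (hc a)).1
    unfold lcb
    linarith

lemma gapPlus_of_mem_ucbSet {u : X} (hu : u ∈ ucbSet E t h) :
    gapPlus E t h u = 2 * (E.scale t h * E.width t h u) := by
  have : Nonempty X := ⟨u⟩
  have : ⨆ a, ucb E t h a = ucb E t h u :=
    le_antisymm (ciSup_le hu) (le_ciSup (isCompact_range (continuous_ucb E t h)).bddAbove u)
  rw [gapPlus, this, ucb, lcb]
  ring

lemma exists_ucb_min_noise [Nonempty X] {ρ : X → ℝ} (hρ : Continuous ρ) :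
    ∃ u ∈ ucbSet E t h, ∀ a ∈ ucbSet E t h, ρ u ≤ ρ a := by
  have hcl : IsClosed (ucbSet E t h) := by
    simp only [ucbSet, Set.ofPred_forall]
    exact isClosed_iInter fun b => isClosed_le continuous_const (continuous_ucb E t h)
  have hne : (ucbSet E t h).Nonempty := by
    obtain ⟨u, -, hu⟩ := isCompact_univ.exists_isMaxOn Set.univ_nonempty
      (continuous_ucb E t h).continuousOn
    exact ⟨u, fun a => hu (Set.mem_univ a)⟩
  obtain ⟨u, hu, hm⟩ := hcl.isCompact.exists_isMinOn hne hρ.continuousOn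
  exact ⟨u, hu, fun a ha => hm ha⟩

lemma iInf_ucbSet_eq {ρ : X → ℝ} {u : X} (hu : u ∈ ucbSet E t h)
    (hm : ∀ a ∈ ucbSet E t h, ρ u ≤ ρ a) : ⨅ a : ucbSet E t h, ρ a = ρ u := by
  have : Nonempty (ucbSet E t h) := ⟨⟨u, hu⟩⟩
  exact le_antisymm (ciInf_le (f := fun a : ucbSet E t h => ρ a)
    ⟨ρ u, by rintro _ ⟨a, rfl⟩; exact hm a a.2⟩ ⟨u, hu⟩)
    (le_ciInf fun a => hm a a.2)

variable {Ω : Type*} {ρ : X → ℝ} (x : ℕ → Ω → X) (y : ℕ → Ω → ℝ) (ω : Ω)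

/-- Compactness bounds `ρ`, so the real supremum over all rounds is a genuine one. -/
lemma iInf_ucbSet_le_noiseLevel [Nonempty X] (hρ : Continuous ρ) :
    ⨅ a : ucbSet E t (hist x y t ω), ρ a ≤ noiseLevel ρ E x y ω := by
  obtain ⟨M, hM⟩ := (isCompact_range hρ).bddAbove
  refine le_ciSup (f := fun t => ⨅ a : ucbSet E t (hist x y t ω), ρ a) ⟨M, ?_⟩ t
  rintro _ ⟨s, rfl⟩
  obtain ⟨u, hu, hm⟩ := exists_ucb_min_noise E s (hist x y s ω) hρ
  dsimp only
  rw [iInf_ucbSet_eq E s _ hu hm]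
  exact hM ⟨u, rfl⟩

lemma le_noiseLevel [Nonempty X] (hρ : Continuous ρ) {r : ℝ} (hr : ∀ a, r ≤ ρ a) :
    r ≤ noiseLevel ρ E x y ω := by
  refine le_trans ?_ (iInf_ucbSet_le_noiseLevel E 0 x y ω hρ)
  obtain ⟨u, hu, hm⟩ := exists_ucb_min_noise E 0 (hist x y 0 ω) hρ
  rw [iInf_ucbSet_eq E 0 _ hu hm]
  exact hr u

end Gap

/-! ### The surrogate ratio. -/

section Ratio

variable {X : Type*} [MetricSpace X] [MeasurableSpace X]
  {E : Estimator X} {ρ : X → ℝ} {info : ∀ t : ℕ, Hist X t → X → ℝ}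

/-- From `log (1 + s) ≥ s / (1 + s)` and `1 + s ≤ exp B`; this is where the factor `exp B` arises.
-/
lemma le_exp_mul_log {s B : ℝ} (hs : 0 ≤ s) (hB : Real.log (1 + s) ≤ B) :
    s ≤ Real.exp B * Real.log (1 + s) := by
  have h1 : 1 + s ≤ Real.exp B := (Real.log_le_iff_le_exp (by positivity)).1 hB
  have h2 := Real.one_sub_inv_le_log_of_pos (show 0 < 1 + s by positivity)
  have h3 : 1 - (1 + s)⁻¹ = s / (1 + s) := by field_simp; ring
  rw [h3, div_le_iff₀ (by positivity)] at h2
  have := mul_le_mul_of_nonneg_left h1 (Real.log_nonneg (show 1 ≤ 1 + s by linarith))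
  linarith

lemma integral_gapPlus_le_of_ratioPlus_le (hI : IsUCBInfo E ρ info) {t : ℕ}
    {h : Hist X t} {ν : Measure X} {K : ℝ} (hK : 0 ≤ K)
    (hr : ratioPlus E info t h ν ≤ ENNReal.ofReal (K ^ 2)) :
    ∫ a, gapPlus E t h a ∂ν ≤ K * √(∫ a, info t h a ∂ν) := by
  have h0 : 0 ≤ ∫ a, info t h a ∂ν := integral_nonneg (hI.nonneg t h)
  have h2 : ENNReal.ofReal ((∫ a, gapPlus E t h a ∂ν) ^ 2) ≤
      ENNReal.ofReal (K ^ 2) * ENNReal.ofReal (∫ a, info t h a ∂ν) := by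
    -- Without information, a finite ratio forces the mean surrogate gap to vanish.
    by_cases hz : ENNReal.ofReal (∫ a, info t h a ∂ν) = 0
    · rw [ratioPlus, hz] at hr
      by_cases hz' : ENNReal.ofReal ((∫ a, gapPlus E t h a ∂ν) ^ 2) = 0
      · rw [hz']; exact zero_le
      · rw [ENNReal.div_zero hz'] at hr
        exact absurd hr (not_le.2 ENNReal.ofReal_lt_top)
    · exact (ENNReal.div_le_iff_le_mul (Or.inl hz) (Or.inl ENNReal.ofReal_ne_top)).1 hr
  rw [← ENNReal.ofReal_mul (sq_nonneg _),
    ENNReal.ofReal_le_ofReal_iff (mul_nonneg (sq_nonneg _) h0)] at h2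
  refine (le_abs_self _).trans ((Real.abs_le_sqrt h2).trans_eq ?_)
  rw [Real.sqrt_mul (sq_nonneg _), Real.sqrt_sq hK]

variable [CompactSpace X] [BorelSpace X]

/-- The surrogate ratio of a UCB action of minimal noise. -/
lemma exists_ratioPlus_dirac_le (hρ : ∀ a, 0 < ρ a) (hI : IsUCBInfo E ρ info) {t : ℕ}
    {h : Hist X t} {B : ℝ} (hB : ∀ a, info t h a ≤ B) :
    ∃ u, ratioPlus E info t h (Measure.dirac u) ≤ ENNReal.ofReal
      ((2 * Real.exp (B / 2) * ((⨅ a : ucbSet E t h, ρ a) * E.scale t h)) ^ 2) := by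
  obtain ⟨u, hu, hm, hi⟩ := hI.exists_ucb t h
  refine ⟨u, ?_⟩
  rw [iInf_ucbSet_eq E t h hu hm, ratioPlus, integral_dirac, integral_dirac,
    gapPlus_of_mem_ucbSet E t h hu]
  refine ENNReal.div_le_of_le_mul ?_
  rw [← ENNReal.ofReal_mul (sq_nonneg _)]
  refine ENNReal.ofReal_le_ofReal ?_
  have hs : 0 ≤ E.width t h u ^ 2 / ρ u ^ 2 := by positivity
  have key := le_exp_mul_log hs (hi ▸ hB u : infoF E ρ t h u ≤ B)
  rw [div_le_iff₀ (pow_pos (hρ u) 2)] at key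
  have he : Real.exp (B / 2) ^ 2 = Real.exp B := by
    rw [← Real.exp_nat_mul]; congr 1; push_cast; ring
  have := mul_le_mul_of_nonneg_left key (show 0 ≤ 4 * E.scale t h ^ 2 by positivity)
  rw [hi, infoF]
  calc (2 * (E.scale t h * E.width t h u)) ^ 2 = 4 * E.scale t h ^ 2 * E.width t h u ^ 2 := by ring
    _ ≤ _ := this
    _ = _ := by rw [← he]; ring

end Ratio

/-! ### Summation over rounds by Cauchy-Schwarz. -/

section Sums

lemma sum_sqrt_le {T : ℕ} {J : ℕ → ℝ} (hJ : ∀ t, 0 ≤ J t) :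
    ∑ t ∈ Finset.range T, √(J t) ≤ √(T * ∑ t ∈ Finset.range T, J t) := by
  refine Real.le_sqrt_of_sq_le ?_
  have := sq_sum_le_card_mul_sum_sq (s := Finset.range T) (f := fun t => √(J t))
  simpa [Real.sq_sqrt (hJ _)] using this

lemma sum_le_mul_sqrt {T : ℕ} {G J β : ℕ → ℝ} {A r : ℝ} (hA : 0 ≤ A) (hr : 0 ≤ r)
    (hβ0 : ∀ t, 0 ≤ β t) (hβ : Monotone β) (hJ : ∀ t, 0 ≤ J t)
    (hG : ∀ t, G t ≤ A * (r * β t) * √(J t)) :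
    ∑ t ∈ Finset.range T, G t ≤ A * (r * β (T - 1) * √(T * ∑ t ∈ Finset.range T, J t)) := by
  have h0 := hβ0 (T - 1)
  calc ∑ t ∈ Finset.range T, G t
      ≤ ∑ t ∈ Finset.range T, A * (r * β (T - 1)) * √(J t) := by
        refine Finset.sum_le_sum fun t ht => (hG t).trans ?_
        -- Rounds are numbered from 0, so `T - 1` is the last of them; for `T = 0` the sum is empty.
        have : β t ≤ β (T - 1) := hβ (Nat.le_sub_one_of_lt (Finset.mem_range.1 ht))
        gcongr
    _ = A * (r * β (T - 1)) * ∑ t ∈ Finset.range T, √(J t) := by rw [Finset.mul_sum]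
    _ ≤ A * (r * β (T - 1)) * √(T * ∑ t ∈ Finset.range T, J t) := by
        gcongr
        exact sum_sqrt_le hJ
    _ = _ := by ring

end Sums

section WithProb

variable {Ω : Type*} [MeasurableSpace Ω] {P : Measure Ω}

lemma WithProb.and {p q : ℝ} {Q Q' : Ω → Prop} (hp : 0 ≤ p) (hq : 0 ≤ q) (h : WithProb P p Q)
    (h' : WithProb P q Q') : WithProb P (p + q) fun ω => Q ω ∧ Q' ω := by
  rw [WithProb, ENNReal.ofReal_add hp hq]
  refine (measure_mono fun ω hω => ?_).trans ((measure_union_le _ _).trans (add_le_add h h'))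
  exact not_and_or.1 hω

lemma WithProb.mono_ae {p : ℝ} {Q Q' : Ω → Prop} (h : WithProb P p Q)
    (h' : ∀ᵐ ω ∂P, Q ω → Q' ω) : WithProb P p Q' := by
  refine le_trans (measure_mono_ae ?_) h
  filter_upwards [h'] with ω hω hn hQ
  exact hn (hω hQ)

end WithProb

/-! ### Regret bounds along a run. -/

section Runs

variable {X Ω : Type*} [MetricSpace X] [CompactSpace X] [MeasurableSpace X] [BorelSpace X]
  [MeasurableSpace Ω] {P : Measure Ω} [IsProbabilityMeasure P] {f ρ : X → ℝ} {E : Estimator X}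
  {info : ∀ t : ℕ, Hist X t → X → ℝ} {π : Policy X} {x : ℕ → Ω → X} {y ε : ℕ → Ω → ℝ}

/-- A real essential supremum dominates only if some almost sure bound exists; `T * B` is one. -/
lemma InfoBounded.ae_sum_le_maxInfo {B : ℝ} (hB : InfoBounded P info x y B) :
    ∀ᵐ ω ∂P, ∀ T : ℕ, ∑ t ∈ Finset.range T, info t (hist x y t ω) (x t ω) ≤
      maxInfo P info x y T := by
  refine ae_all_iff.2 fun T => ae_le_essSup ⟨T * B, ?_⟩
  rw [Filter.eventually_map]
  filter_upwards [hB] with ω hω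
  exact (Finset.sum_le_sum fun t _ => hω t (x t ω)).trans_eq (by simp)

lemma InfoBounded.maxInfo_nonneg (hI : IsUCBInfo E ρ info) {B : ℝ}
    (hB : InfoBounded P info x y B) (T : ℕ) : 0 ≤ maxInfo P info x y T := by
  obtain ⟨ω, hω⟩ := (hB.ae_sum_le_maxInfo).exists
  exact (Finset.sum_nonneg fun t _ => hI.nonneg t _ _).trans (hω T)

lemma integrable_of_continuous {ν : Measure X} [IsFiniteMeasure ν] {g : X → ℝ}
    (hg : Continuous g) : Integrable g ν :=
  hg.integrable_of_hasCompactSupport (HasCompactSupport.of_compactSpace g)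

/-- If the ratio of the played distributions is at most that of the UCB actions, then the sum of
the mean surrogate gaps is controlled by the sum of the mean information gains. -/
lemma sum_gapPlus_le (hρ : Continuous ρ) (hρ0 : ∀ a, 0 < ρ a)
    (hI : IsUCBInfo E ρ info) {B : ℝ} {ω : Ω} (hB : ∀ t a, info t (hist x y t ω) a ≤ B)
    (hβ : Monotone fun t => E.scale t (hist x y t ω)) {ν : ℕ → Measure X}
    (hν : ∀ t u, ratioPlus E info t (hist x y t ω) (ν t) ≤
      ratioPlus E info t (hist x y t ω) (Measure.dirac u)) (T : ℕ) :
    ∑ t ∈ Finset.range T, ∫ a, gapPlus E t (hist x y t ω) a ∂ν t ≤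
      2 * Real.exp (B / 2) * (noiseLevel ρ E x y ω * scaleAt E x y T ω *
        √(T * ∑ t ∈ Finset.range T, ∫ a, info t (hist x y t ω) a ∂ν t)) := by
  have : Nonempty X := ⟨x 0 ω⟩
  have hR : 0 ≤ noiseLevel ρ E x y ω := le_noiseLevel E x y ω hρ fun a => (hρ0 a).le
  refine sum_le_mul_sqrt (β := fun t => E.scale t (hist x y t ω)) (by positivity) hR
    (fun t => (E.scale_pos t _).le) hβ (fun t => integral_nonneg (hI.nonneg t _)) fun t => ?_
  have hs := (E.scale_pos t (hist x y t ω)).le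
  refine integral_gapPlus_le_of_ratioPlus_le hI (by positivity) ?_
  obtain ⟨u, hu⟩ := exists_ratioPlus_dirac_le hρ0 hI (hB t)
  refine (hν t u).trans (hu.trans (ENNReal.ofReal_le_ofReal ?_))
  have h0 : 0 ≤ ⨅ a : ucbSet E t (hist x y t ω), ρ a := Real.iInf_nonneg fun a => (hρ0 a).le
  have := iInf_ucbSet_le_noiseLevel E t x y ω hρ
  gcongr

/-- There is only one empty history, so the initial scale is deterministic, and its product with
`min ρ` is a deterministic lower bound. This makes `T₀` deterministic below. -/
lemma exists_le_noiseLevel_mul_scaleAt (hρ : Continuous ρ) (hρ0 : ∀ a, 0 < ρ a)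
    (hβ : ∀ᵐ ω ∂P, Monotone fun t => E.scale t (hist x y t ω)) :
    ∃ d : ℝ, 0 < d ∧ ∀ᵐ ω ∂P, ∀ T, d ≤ noiseLevel ρ E x y ω * scaleAt E x y T ω := by
  obtain ⟨ω₀⟩ : Nonempty Ω := nonempty_of_isProbabilityMeasure P
  have : Nonempty X := ⟨x 0 ω₀⟩
  obtain ⟨a₀, -, ha₀⟩ := isCompact_univ.exists_isMinOn Set.univ_nonempty hρ.continuousOn
  refine ⟨ρ a₀ * E.scale 0 (hist x y 0 ω₀), mul_pos (hρ0 a₀) (E.scale_pos _ _), ?_⟩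
  filter_upwards [hβ] with ω hω T
  rw [Subsingleton.elim (hist x y 0 ω₀) (hist x y 0 ω)]
  have h1 := le_noiseLevel E x y ω hρ fun a => ha₀ (Set.mem_univ a)
  have h2 : E.scale 0 (hist x y 0 ω) ≤ scaleAt E x y T ω := hω (Nat.zero_le (T - 1))
  exact mul_le_mul h1 h2 (E.scale_pos _ _).le ((hρ0 a₀).le.trans h1)

/-- The regret bound for information directed sampling, with separate failure probabilities for
the two concentration inequalities. -/
lemma IsIDS.withProb_regret_le (hf : Continuous f) (hρ : Continuous ρ) (hρ0 : ∀ a, 0 < ρ a)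
    (hr : IsRun P f π x y ε) (hβ : ∀ᵐ ω ∂P, Monotone fun t => E.scale t (hist x y t ω))
    {α δ₁ δ₂ B : ℝ} (hα : 0 ≤ α) (hδ₁ : 0 < δ₁) (hδ₂ : 0 < δ₂) (hB1 : 1 ≤ B)
    (hc : ConfidenceBounds P f E x y α) (hI : IsUCBInfo E ρ info)
    (hB : InfoBounded P info x y B) (hπ : IsIDS E info π) {l : ℝ}
    (hl2 : Real.log (1 / δ₂) ≤ 2 * l) :
    WithProb P (α + (δ₁ + δ₂)) fun ω => ∀ T : ℕ,
      regret f x T ω ≤ 8 * Real.exp (B / 2) * √B * (noiseLevel ρ E x y ω * scaleAt E x y T ω *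
        √(T * (maxInfo P info x y T + l))) + maxGap f * Real.log (1 / δ₁) := by
  obtain ⟨ω₀⟩ : Nonempty Ω := nonempty_of_isProbabilityMeasure P
  have hX : Nonempty X := ⟨x 0 ω₀⟩
  have hS : 0 ≤ maxGap f := (gap_nonneg hf (x 0 ω₀)).trans (gap_le_maxGap hf _)
  have hB0 : 0 < B := by linarith
  -- Concentration is applied to the true gap, which is bounded by `S`, and not to its surrogate.
  have c1 := hr.withProb_sum_le_condExp hf.measurable (g := fun _ _ a => gap f a) hS hδ₁
    (fun t => (continuous_gap hf).measurable.comp measurable_snd)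
    (fun _ _ => gap_nonneg hf) (fun _ _ => gap_le_maxGap hf)
  -- The gain is bounded by `B` only almost surely along the run, hence the truncation, which is
  -- removed once `hBω` is at hand.
  have c2 := hr.withProb_condExp_sum_le hf.measurable (g := fun t h a => min (info t h a) B)
    hB0 hδ₂ (fun t => (hI.measurable t).min measurable_const)
    (fun t h a => le_min (hI.nonneg t h a) hB0.le) (fun t h a => min_le_right _ _)
  refine (WithProb.and hα (by positivity) hc (c1.and hδ₁.le hδ₂.le c2)).mono_ae ?_
  filter_upwards [hβ, hB, hB.ae_sum_le_maxInfo] with ω hβω hBω hmω ⟨h0, h1, h2⟩ T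
  simp only [min_eq_left (hBω _ _)] at h2
  have hπp : ∀ t, IsProbabilityMeasure (π.dist t (hist x y t ω)) := fun t =>
    have := π.isMarkov t; inferInstance
  have hγ := hB.maxInfo_nonneg hI T
  have hsum := sum_gapPlus_le hρ hρ0 hI hBω hβω
    (ν := fun t => π.dist t (hist x y t ω)) (fun t u => hπ t _ _ inferInstance) T
  have hle : ∑ t ∈ Finset.range T, ∫ a, gap f a ∂π.dist t (hist x y t ω) ≤
      ∑ t ∈ Finset.range T, ∫ a, gapPlus E t (hist x y t ω) a ∂π.dist t (hist x y t ω) :=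
    Finset.sum_le_sum fun t _ => integral_mono (integrable_of_continuous (continuous_gap hf))
      (integrable_of_continuous (continuous_gapPlus E t _)) (gap_le_gapPlus E t _ (h0 t))
  have hinfo : ∑ t ∈ Finset.range T, ∫ a, info t (hist x y t ω) a ∂π.dist t (hist x y t ω) ≤
      4 * B * (maxInfo P info x y T + l) := by
    have e1 := h2 T
    have e2 := hmω T
    have e3 := mul_le_mul_of_nonneg_left hl2 hB0.le
    have e4 := mul_le_mul_of_nonneg_right hB1 hγ
    linarith
  have hR : 0 ≤ noiseLevel ρ E x y ω := le_noiseLevel E x y ω hρ fun a => (hρ0 a).le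
  have hs : 0 ≤ scaleAt E x y T ω := (E.scale_pos _ _).le
  have hsq : √(T * ∑ t ∈ Finset.range T,
      ∫ a, info t (hist x y t ω) a ∂π.dist t (hist x y t ω)) ≤
      2 * √B * √(T * (maxInfo P info x y T + l)) := by
    refine (Real.sqrt_le_sqrt (mul_le_mul_of_nonneg_left hinfo (Nat.cast_nonneg T))).trans_eq ?_
    rw [show T * (4 * B * (maxInfo P info x y T + l)) =
      (2 * √B) ^ 2 * (T * (maxInfo P info x y T + l)) by
        rw [mul_pow, Real.sq_sqrt hB0.le]; ring,
      Real.sqrt_mul (sq_nonneg _), Real.sqrt_sq (by positivity)]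
  -- The constant 8 is 2 from the realized gaps, 2 from the ratio and 2 from `√(4 * B)`.
  have hfin := mul_le_mul_of_nonneg_left hsq
    (show 0 ≤ 2 * Real.exp (B / 2) * (noiseLevel ρ E x y ω * scaleAt E x y T ω) by positivity)
  have h1T := h1 T
  have h3 := regret_le_sum_gap hf x T ω
  linarith

/-- Information directed sampling satisfies the regret bound for randomized policies. -/
theorem IsIDS.randomizedRegretBound (hf : Continuous f) (hρ : Continuous ρ) (hρ0 : ∀ a, 0 < ρ a)
    (hr : IsRun P f π x y ε) (hβ : ∀ᵐ ω ∂P, Monotone fun t => E.scale t (hist x y t ω))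
    {α δ B : ℝ} (hα : 0 ≤ α) (hδ : 0 < δ) (hδ1 : δ < 1) (hB1 : 1 ≤ B)
    (hc : ConfidenceBounds P f E x y α) (hI : IsUCBInfo E ρ info)
    (hB : InfoBounded P info x y B) (hπ : IsIDS E info π) :
    RandomizedRegretBound (8 * Real.exp (B / 2) * √B + 1) α δ P f ρ E info x y := by
  obtain ⟨ω₀⟩ : Nonempty Ω := nonempty_of_isProbabilityMeasure P
  have hX : Nonempty X := ⟨x 0 ω₀⟩
  have hS : 0 ≤ maxGap f := (gap_nonneg hf (x 0 ω₀)).trans (gap_le_maxGap hf _)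
  constructor
  · have hl : 0 < Real.log (1 / δ) := Real.log_pos ((one_lt_div hδ).2 hδ1)
    -- Splitting `δ` into `δ - δ²` and `δ²` gives `log (1 / δ²) = 2 log (1 / δ)`, so the main term
    -- keeps `log (1 / δ)`. The gap term `L` is then constant in `T`.
    have hδ₁ : 0 < δ - δ ^ 2 := by nlinarith
    obtain ⟨d, hd, hdω⟩ := exists_le_noiseLevel_mul_scaleAt (P := P) (x := x) (y := y) (E := E)
      hρ hρ0 hβ
    set L := maxGap f * Real.log (1 / (δ - δ ^ 2))
    -- From `T₀` on, `d √(T log (1 / δ)) ≥ L`, so the `+ 1` in the constant absorbs `L`.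
    obtain ⟨T₀, hT₀⟩ := exists_nat_ge ((L / d) ^ 2 / Real.log (1 / δ))
    have key := hπ.withProb_regret_le hf hρ hρ0 hr hβ hα hδ₁ (pow_pos hδ 2) hB1 hc hI hB
      (l := Real.log (1 / δ))
      (by rw [one_div, one_div, Real.log_inv, Real.log_inv, Real.log_pow]; push_cast; linarith)
    rw [sub_add_cancel] at key
    refine ⟨T₀, key.mono_ae ?_⟩
    filter_upwards [hdω] with ω hd' h T _ hT
    have hγ := hB.maxInfo_nonneg hI T
    refine (h T).trans ?_
    rw [add_mul _ 1, one_mul]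
    refine add_le_add_right ?_ _
    have h1 : L / d ≤ √(T * (maxInfo P info x y T + Real.log (1 / δ))) := by
      refine (le_abs_self _).trans (Real.abs_le_sqrt ?_)
      rw [div_le_iff₀ hl] at hT₀
      have hT' : (T₀ : ℝ) ≤ T := by exact_mod_cast hT
      have := mul_le_mul_of_nonneg_right hT' hl.le
      have := mul_nonneg (Nat.cast_nonneg (α := ℝ) T) hγ
      linarith
    calc L = d * (L / d) := by field_simp
      _ ≤ d * √(T * (maxInfo P info x y T + Real.log (1 / δ))) :=
        mul_le_mul_of_nonneg_left h1 hd.le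
      _ ≤ _ := mul_le_mul_of_nonneg_right (hd' T) (Real.sqrt_nonneg _)
  · have hl : 0 ≤ Real.log (2 / δ) := Real.log_nonneg ((one_le_div hδ).2 (by linarith))
    have he : 1 / (δ / 2) = 2 / δ := one_div_div δ 2
    have key := hπ.withProb_regret_le hf hρ hρ0 hr hβ hα (half_pos hδ) (half_pos hδ) hB1 hc hI hB
      (l := Real.log (2 / δ)) (by rw [he]; linarith)
    rw [add_halves, he] at key
    refine key.mono_ae (Filter.Eventually.of_forall fun ω h T hT => (h T).trans ?_)
    have hT' : (1 : ℝ) ≤ T := by exact_mod_cast hT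
    have h1 : Real.log (2 / δ) ≤ Real.log (2 * T / δ) := by
      refine Real.log_le_log (by positivity) ?_
      gcongr
      linarith
    have hR : 0 ≤ noiseLevel ρ E x y ω := le_noiseLevel E x y ω hρ fun a => (hρ0 a).le
    have hs : 0 ≤ scaleAt E x y T ω := (E.scale_pos _ _).le
    have hC : 0 ≤ 8 * Real.exp (B / 2) * √B := by positivity
    have h2 := mul_le_mul_of_nonneg_left h1 hS
    have h3 : 0 ≤ noiseLevel ρ E x y ω * scaleAt E x y T ω *
      √(T * (maxInfo P info x y T + Real.log (2 / δ))) := by positivity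
    have h4 := mul_nonneg hC ((mul_nonneg hS hl).trans h2)
    linarith

/-- A policy that plays single actions almost surely plays these actions along a run. -/
lemma IsRun.ae_eq_of_dirac (hr : IsRun P f π x y ε) (hf : Measurable f)
    {a : ∀ t : ℕ, Hist X t → X} (ha : ∀ t h, π.dist t h = Measure.dirac (a t h)) :
    ∀ᵐ ω ∂P, ∀ t, x t ω = a t (hist x y t ω) := by
  refine ae_all_iff.2 fun t => ?_
  have := π.isMarkov t
  -- The action comes from a choice; it is measurable because it lies in `s` exactly when the kernel
  -- gives `s` mass 1.
  have ham : Measurable (a t) := fun s hs => by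
    have h1 : a t ⁻¹' s = (fun h => π.dist t h s) ⁻¹' {1} := by
      ext h
      by_cases hh : a t h ∈ s <;> simp [ha, Measure.dirac_apply' _ hs, hh]
    rw [h1]
    exact (π.dist t).measurable_coe hs (measurableSet_singleton 1)
  have hset : MeasurableSet {p : Hist X t × X | p.2 = a t p.1} :=
    measurableSet_eq_fun measurable_snd (ham.comp measurable_fst)
  have h2 : ∀ᵐ p ∂((P.map (hist x y t)) ⊗ₘ π.dist t), p.2 = a t p.1 := by
    rw [Measure.ae_compProd_iff hset]
    refine Filter.Eventually.of_forall fun h => ?_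
    change ∀ᵐ b ∂π.dist t h, b = a t h
    rw [ha, ae_dirac_iff measurableSet_eq]
  rw [← hr.action_law t] at h2
  exact ae_of_ae_map ((hr.measurable_hist hf t).prodMk (hr.measurable_action t)).aemeasurable h2

/-- Deterministic information directed sampling satisfies the regret bound for deterministic
policies. -/
theorem IsDIDS.deterministicRegretBound (hf : Continuous f) (hρ : Continuous ρ)
    (hρ0 : ∀ a, 0 < ρ a) (hr : IsRun P f π x y ε)
    (hβ : ∀ᵐ ω ∂P, Monotone fun t => E.scale t (hist x y t ω))
    {α B : ℝ} (hB1 : 1 ≤ B) (hc : ConfidenceBounds P f E x y α) (hI : IsUCBInfo E ρ info)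
    (hB : InfoBounded P info x y B) (hπ : IsDIDS E info π) :
    DeterministicRegretBound (8 * Real.exp (B / 2) * √B + 1) α P f ρ E info x y := by
  choose a ha hmin using hπ
  refine WithProb.mono_ae hc ?_
  filter_upwards [hβ, hB, hB.ae_sum_le_maxInfo, hr.ae_eq_of_dirac hf.measurable ha]
    with ω hβω hBω hmω hxω h0 T _
  have : Nonempty X := ⟨x 0 ω⟩
  -- The Dirac measure at the played action turns means into realized values, so no concentration is
  -- needed.
  have hsum := sum_gapPlus_le hρ hρ0 hI hBω hβω (ν := fun t => Measure.dirac (x t ω))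
    (fun t u => by rw [hxω t]; exact hmin t _ u) T
  simp only [integral_dirac] at hsum
  have h1 := regret_le_sum_gap hf x T ω
  have h2 : ∑ t ∈ Finset.range T, gap f (x t ω) ≤
      ∑ t ∈ Finset.range T, gapPlus E t (hist x y t ω) (x t ω) :=
    Finset.sum_le_sum fun t _ => gap_le_gapPlus E t _ (h0 t) _
  have hR : 0 ≤ noiseLevel ρ E x y ω := le_noiseLevel E x y ω hρ fun a => (hρ0 a).le
  have hs : 0 ≤ scaleAt E x y T ω := (E.scale_pos _ _).le
  refine h1.trans (h2.trans (hsum.trans ?_))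
  have hB' : 1 ≤ √B := Real.one_le_sqrt.2 hB1
  have h3 := le_mul_of_one_le_right (Real.exp_pos (B / 2)).le hB'
  have h4 := Real.exp_pos (B / 2)
  have h5 : 2 * Real.exp (B / 2) ≤ 8 * Real.exp (B / 2) * √B + 1 := by linarith
  gcongr
  exact hmω T

lemma isUCBInfo_infoF [Nonempty X] (hρ : Continuous ρ) : IsUCBInfo E ρ (infoF E ρ) where
  measurable := measurable_infoF E hρ.measurable
  nonneg t h a := Real.log_nonneg (le_add_of_nonneg_right (by positivity))
  exists_ucb t h := by
    obtain ⟨u, hu, hm⟩ := exists_ucb_min_noise E t h hρ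
    exact ⟨u, hu, hm, rfl⟩

lemma isUCBInfo_infoUCB {H : Type*} [NormedAddCommGroup H] [InnerProductSpace ℝ H]
    [CompleteSpace H] {φ : X → H} {V₀ : H →L[ℝ] H} {u : ∀ t : ℕ, Hist X t → X}
    (hE : HasLeastSquaresWidth E ρ φ V₀) (hu : IsUCBChoice E ρ u) :
    IsUCBInfo E ρ (infoUCB E u) where
  measurable := measurable_infoUCB E hu.measurable
  nonneg := infoUCB_nonneg hE u
  exists_ucb t h := ⟨u t h, hu.mem t h, hu.noise_le t h, infoUCB_self hE u t h⟩

end Runs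

end FreqIDS


theorem mainTheorem2 (B : ℝ) : ∃ C : ℝ, 0 < C ∧
    ∀ (X : Type*) [MetricSpace X] [CompactSpace X] [MeasurableSpace X] [BorelSpace X]
      (Ω : Type*) [MeasurableSpace Ω] (P : Measure Ω) [IsProbabilityMeasure P]
      (f ρ : X → ℝ) (_ : Continuous f) (_ : Continuous ρ) (_ : ∀ a, 0 < ρ a)
      (E : FreqIDS.Estimator X) (π : FreqIDS.Policy X)
      (x : ℕ → Ω → X) (y ε : ℕ → Ω → ℝ) (_ : FreqIDS.IsRun P f π x y ε)
      (_ : ∀ᵐ ω ∂P, Monotone fun t => E.scale t (FreqIDS.hist x y t ω))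
      (α δ : ℝ) (_ : 0 ≤ α) (_ : 0 < δ) (_ : δ < 1)
      (_ : FreqIDS.ConfidenceBounds P f E x y α),
      -- IDS-F and DIDS-F
      (FreqIDS.InfoBounded P (FreqIDS.infoF E ρ) x y B →
        (FreqIDS.IsIDS E (FreqIDS.infoF E ρ) π →
          FreqIDS.RandomizedRegretBound C α δ P f ρ E (FreqIDS.infoF E ρ) x y) ∧
        (FreqIDS.IsDIDS E (FreqIDS.infoF E ρ) π →
          FreqIDS.DeterministicRegretBound C α P f ρ E (FreqIDS.infoF E ρ) x y)) ∧
      -- IDS-UCB and DIDS-UCB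
      (∀ (H : Type*) [NormedAddCommGroup H] [InnerProductSpace ℝ H] [CompleteSpace H]
        (φ : X → H) (V₀ : H →L[ℝ] H) (u : ∀ t : ℕ, FreqIDS.Hist X t → X),
        FreqIDS.HasLeastSquaresWidth E ρ φ V₀ → FreqIDS.IsUCBChoice E ρ u →
        FreqIDS.InfoBounded P (FreqIDS.infoUCB E u) x y B →
        (FreqIDS.IsIDS E (FreqIDS.infoUCB E u) π →
          FreqIDS.RandomizedRegretBound C α δ P f ρ E (FreqIDS.infoUCB E u) x y) ∧
        (FreqIDS.IsDIDS E (FreqIDS.infoUCB E u) π →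
          FreqIDS.DeterministicRegretBound C α P f ρ E (FreqIDS.infoUCB E u) x y)) := by
  -- Enlarging `B` to at least 1 only weakens the boundedness hypothesis and lets `B` absorb
  -- numerical factors.
  have h1 : 1 ≤ max B 1 := le_max_right B 1
  refine ⟨8 * Real.exp (max B 1 / 2) * √(max B 1) + 1, by positivity, ?_⟩
  intro X _ _ _ _ Ω _ P _ f ρ hf hρ hρ0 E π x y ε hr hβ α δ hα hδ hδ1 hc
  have hmono : ∀ info : ∀ t : ℕ, FreqIDS.Hist X t → X → ℝ, FreqIDS.InfoBounded P info x y B →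
      FreqIDS.InfoBounded P info x y (max B 1) := fun info hB => by
    filter_upwards [hB] with ω hω t a
    exact (hω t a).trans (le_max_left B 1)
  refine ⟨fun hB => ?_, fun H _ _ _ φ V₀ u hE hu hB => ?_⟩
  · obtain ⟨ω₀⟩ : Nonempty Ω := nonempty_of_isProbabilityMeasure P
    have : Nonempty X := ⟨x 0 ω₀⟩
    have hI := FreqIDS.isUCBInfo_infoF (E := E) hρ
    exact ⟨fun hπ => hπ.randomizedRegretBound hf hρ hρ0 hr hβ hα hδ hδ1 h1 hc hI (hmono _ hB),
      fun hπ => hπ.deterministicRegretBound hf hρ hρ0 hr hβ h1 hc hI (hmono _ hB)⟩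
  · have hI := FreqIDS.isUCBInfo_infoUCB hE hu
    exact ⟨fun hπ => hπ.randomizedRegretBound hf hρ hρ0 hr hβ hα hδ hδ1 h1 hc hI (hmono _ hB),
      fun hπ => hπ.deterministicRegretBound hf hρ hρ0 hr hβ h1 hc hI (hmono _ hB)⟩
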